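/- Setting. A base station with $M$ antennas serves $K$ single-antenna users through a RIS with $N$ reflecting elements, in the presence of an eavesdropper (Eve) with $M_{\rm E}$ antennas, $K+M_{\rm E}<M$. The path losses $\beta_1$ (base station–RIS), $\beta_{{\rm I},k}$ (RIS–user $k$), $\beta_{2,k}$ (base station–user $k$), $\beta_{\rm I,E}$ (RIS–Eve), $\beta_3$ (base station–Eve) are positive; $P>0$ is the total power, $\xi\in[0,1]$ the fraction of it allocated to information, $\sigma_k^2>0$ the noise variance at user $k$. The channel from base station to RIS is ${\bf H}_1\in\mathbb C^{M\times N}$ with $[{\bf H}_1]_{m,n}=\sqrt{\beta_1}e^{-j2\pi d_{m,n}/\lambda}$, where $\lambda>0$ is the wavelength and $d_{m,n}$ are distances, and ${\bf\Phi}={\rm diag}(e^{j\theta_1},\dots,e^{j\theta_N})$ is the RIS phase-shift matrix. For correlation matrices ${\bf R}_{{\rm I},k},{\bf R}_{\rm I,E}\in\mathbb C^{N\times N}$, ${\bf R}_{{\rm B},k},{\bf R}_{\rm B,E}\in\mathbb C^{M\times M}$ put ${\bf R}_k=\beta_{2,k}{\bf R}_{{\rm B},k}+\beta_{{\rm I},k}{\bf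 H}_1{\bf\Phi}{\bf R}_{{\rm I},k}{\bf\Phi}^H{\bf H}_1^H$ and ${\bf R}_{\rm E}=\beta_{\rm I,E}{\bf H}_1{\bf\Phi}{\bf R}_{\rm I,E}{\bf\Phi}^H{\bf H}_1^H$. The closed-form ergodic secrecy rate of user $k$ is $R_{\rm sec}=\max\{0,\log_2(1+\gamma_k)-\log_2(1+\gamma_{\rm E})\}$ with $$\gamma_k=\frac{\xi P[{\rm tr}({\bf R}_k)]^2}{\xi P\sum_{i\ne k}{\rm tr}({\bf R}_k{\bf R}_i)+\sigma_k^2\sum_{j=1}^K{\rm tr}({\bf R}_j)},\qquad \gamma_{\rm E}=\frac{\xi MM_{\rm E}(M-K)\,{\rm tr}\big({\bf R}_k({\bf R}_{\rm E}+\beta_3{\bf R}_{\rm B,E})\big)}{(1-\xi)(M-K-M_{\rm E})\,{\rm tr}({\bf R}_{\rm E}+\beta_3{\bf R}_{\rm B,E})\sum_{j=1}^K{\rm tr}({\bf R}_j)},$$ where $\xi<1$ whenever $\gamma_{\rm E}$ or $R_{\rm sec}$ is considered. The random channels are ${\bf f}_k={\bf H}_1{\bf\Phi}\sqrt{\beta_{{\rm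 I},k}}{\bf R}_{{\rm I},k}^{1/2}{\bf g}_{{\rm I},k}$ (cascaded, through the RIS) and ${\bf h}_k={\bf f}_k+\sqrt{\beta_{2,k}}{\bf R}_{{\rm B},k}^{1/2}{\bf g}_{{\rm B},k}$, where all entries of all ${\bf g}_{{\rm I},k},{\bf g}_{{\rm B},k}$ are i.i.d. $\mathcal{CN}(0,1)$. With $p=\xi P/K$ and the MRT precoder ${\bf w}_i=\sqrt{K/\sum_j{\rm tr}({\bf R}_j)}\,{\bf h}_i$, the desired-signal power of user $k$ is $D_k=|\mathbb E\{\sqrt p\,{\bf h}_k^H{\bf w}_k\}|^2$ and the power of its inter-user interference is $J_k=\sum_{i\ne k}\mathbb E\{|\sqrt p\,{\bf h}_k^H{\bf w}_i|^2\}$. Corollary. Let the fading be uncorrelated, i.e. ${\bf R}_{{\rm I},k}={\bf R}_{\rm I,E}={\bf I}_N$ and ${\bf R}_{{\rm B},k}={\bf R}_{\rm B,E}={\bf I}_M$ for all $k$. Write $\|\cdot\|$ for the Frobenius norm, $$A_k=\sum_{i\ne k}\big[\beta_{2,k}\beta_{2,i}M+(\beta_{2,k}\beta_{{\rm I},i}+\beta_{{\rm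 I},k}\beta_{2,i})\beta_1MN+\beta_{{\rm I},k}\beta_{{\rm I},i}\|{\bf H}_1{\bf H}_1^H\|^2\big],\qquad B=\sum_{j=1}^K\big[\beta_{{\rm I},j}\beta_1MN+\beta_{2,j}M\big].$$ (a) For every ${\bf\Phi}$, $$\gamma_k=\frac{\xi P\big(\beta_{{\rm I},k}^2\beta_1^2M^2N^2+2\beta_{{\rm I},k}\beta_{2,k}\beta_1M^2N+\beta_{2,k}^2M^2\big)}{\xi P\,A_k+\sigma_k^2B},$$ and, if $\xi<1$, $$\gamma_{\rm E}=\frac{\xi M_{\rm E}(M-K)\big(\beta_{{\rm I},k}\beta_{\rm I,E}\|{\bf H}_1{\bf H}_1^H\|^2+(\beta_{{\rm I},k}\beta_3+\beta_{2,k}\beta_{\rm I,E})\beta_1MN+\beta_{2,k}\beta_3M\big)}{(1-\xi)(M-K-M_{\rm E})(\beta_3+\beta_{\rm I,E}\beta_1N)\,B}.$$ (b) If $\xi<1$, then $R_{\rm sec}$ takes the same value for all phase-shift matrices ${\bf\Phi}$; by (a), it depends on the RIS only through $N$, the path losses and $\|{\bf H}_1{\bf H}_1^H\|$. (c) The inter-user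 interference persists as $M\to\infty$: if $K\ge2$ and $N\ge1$, there is a constant $c>0$, depending only on $K$, $N$, $k$ and the path losses, such that for all $M$, $M_{\rm E}$ with $K+M_{\rm E}<M$, all ${\bf H}_1$ as above, all ${\bf\Phi}$, $P$, $\sigma_k^2$ and all $\xi\in(0,1]$: $\gamma_k\le 1/c$, $J_k=\xi P\,A_k/B$, $D_k>0$, and $J_k\ge c\,D_k$. Moreover, the cascaded channels of different users are not asymptotically orthogonal, because of the common factor ${\bf H}_1$: for all $i\ne k$, $$\frac{\mathbb E\{|{\bf f}_k^H{\bf f}_i|^2\}}{\mathbb E\{\|{\bf f}_k\|^2\}\,\mathbb E\{\|{\bf f}_i\|^2\}}=\frac{\|{\bf H}_1{\bf H}_1^H\|^2}{(\beta_1MN)^2}\ge\frac1N .$$ -/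

import Mathlib

open MeasureTheory ProbabilityTheory
open scoped Matrix ComplexOrder

noncomputable section

namespace RIS

/-- Large-scale path losses: `beta1` (base station to RIS), `betaI k` (RIS to user `k`), `beta2 k`
(base station to user `k`), `betaIE` (RIS to Eve), `beta3` (base station to Eve). -/
structure PathLoss (K : ℕ) where
  beta1 : ℝ
  betaI : Fin K → ℝ
  beta2 : Fin K → ℝ
  betaIE : ℝ
  beta3 : ℝ
  beta1_pos : 0 < beta1
  betaI_pos : ∀ k, 0 < betaI k
  beta2_pos : ∀ k, 0 < beta2 k
  betaIE_pos : 0 < betaIE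
  beta3_pos : 0 < beta3

/-- A RIS-aided multiuser secure system with `K` users, `M` base-station antennas, `N` reflecting
elements and an eavesdropper (Eve) with `ME` antennas. -/
structure System (K M N ME : ℕ) where
  /-- large-scale path losses -/
  loss : PathLoss K
  /-- correlation matrices at the RIS, for the users -/
  RI : Fin K → Matrix (Fin N) (Fin N) ℂ
  /-- correlation matrices at the base station, for the users -/
  RB : Fin K → Matrix (Fin M) (Fin M) ℂ
  /-- correlation matrix at the RIS, for Eve -/
  RIE : Matrix (Fin N) (Fin N) ℂ
  /-- correlation matrix at the base station, for Eve -/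
  RBE : Matrix (Fin M) (Fin M) ℂ
  /-- distance between antenna `m` and reflecting element `n` -/
  d : Fin M → Fin N → ℝ
  /-- carrier wavelength -/
  wavelength : ℝ
  /-- total transmit power -/
  P : ℝ
  /-- fraction of the power that is allocated to the information signal -/
  ξ : ℝ
  /-- noise variance at each user -/
  noiseVar : Fin K → ℝ
  RI_psd : ∀ k, (RI k).PosSemidef
  RB_psd : ∀ k, (RB k).PosSemidef
  RIE_psd : RIE.PosSemidef
  RBE_psd : RBE.PosSemidef
  wavelength_pos : 0 < wavelength
  P_pos : 0 < P
  ξ_nonneg : 0 ≤ ξ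
  ξ_le_one : ξ ≤ 1
  noiseVar_pos : ∀ k, 0 < noiseVar k
  /-- the artificial noise has more dimensions than Eve has antennas -/
  antennas : K + ME < M

/-- The RIS phase-shift matrix `diag(e^{jθ₁}, …, e^{jθ_N})`. -/
def phaseMatrix {N : ℕ} (θ : Fin N → ℝ) : Matrix (Fin N) (Fin N) ℂ :=
  Matrix.diagonal fun n => Complex.exp (Complex.I * (θ n : ℂ))

/-- The squared Frobenius norm. -/
def frobSq {m n : ℕ} (A : Matrix (Fin m) (Fin n) ℂ) : ℝ :=
  ∑ i, ∑ j, ‖A i j‖ ^ 2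

/-- The square root of a positive semidefinite matrix, by the continuous functional calculus. -/
def sqrtMatrix {n : ℕ} (A : Matrix (Fin n) (Fin n) ℂ) : Matrix (Fin n) (Fin n) ℂ :=
  cfc Real.sqrt A

/-- The circularly symmetric complex Gaussian law `CN(0, 1)`. -/
def stdComplexGaussian : Measure ℂ :=
  ((gaussianReal 0 (1 / 2)).prod (gaussianReal 0 (1 / 2))).map
    fun z : ℝ × ℝ => (z.1 : ℂ) + (z.2 : ℂ) * Complex.I

/-- The entries of the vectors `gI k` and `gB k`, `k = 1, …, K`, are i.i.d. `CN(0, 1)`. -/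
structure IsFading {Ω : Type*} [MeasurableSpace Ω] (μ : Measure Ω) {K M N : ℕ}
    (gI : Fin K → Fin N → Ω → ℂ) (gB : Fin K → Fin M → Ω → ℂ) : Prop where
  law_I : ∀ k n, HasLaw (gI k n) stdComplexGaussian μ
  law_B : ∀ k m, HasLaw (gB k m) stdComplexGaussian μ
  indep : iIndepFun
    (fun p : Fin K × (Fin N ⊕ Fin M) => Sum.elim (gI p.1) (gB p.1) p.2) μ

namespace System

variable {K M N ME : ℕ} (S : System K M N ME)

/-- Uncorrelated Rayleigh fading. -/
def IsUncorrelated : Prop :=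
  (∀ k, S.RI k = 1) ∧ (∀ k, S.RB k = 1) ∧ S.RIE = 1 ∧ S.RBE = 1

/-- The line-of-sight channel between the base station and the RIS. -/
def H1 : Matrix (Fin M) (Fin N) ℂ :=
  Matrix.of fun m n => (Real.sqrt S.loss.beta1 : ℂ) *
    Complex.exp (-(Complex.I * ((2 * Real.pi * (S.d m n / S.wavelength) : ℝ) : ℂ)))

/-! ### The closed-form secrecy rate under general correlation -/

/-- `R_k`. -/
def userCov (θ : Fin N → ℝ) (k : Fin K) : Matrix (Fin M) (Fin M) ℂ :=
  (S.loss.beta2 k : ℂ) • S.RB k +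
    (S.loss.betaI k : ℂ) • (S.H1 * phaseMatrix θ * S.RI k * (phaseMatrix θ)ᴴ * S.H1ᴴ)

/-- `R_E`. -/
def eveCov (θ : Fin N → ℝ) : Matrix (Fin M) (Fin M) ℂ :=
  (S.loss.betaIE : ℂ) • (S.H1 * phaseMatrix θ * S.RIE * (phaseMatrix θ)ᴴ * S.H1ᴴ)

/-- `∑ⱼ tr(R_j)`. -/
def sumTrace (θ : Fin N → ℝ) : ℝ :=
  ∑ j, (S.userCov θ j).trace.re

/-- `S_k`. -/
def userSignal (θ : Fin N → ℝ) (k : Fin K) : ℝ :=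
  S.ξ * S.P * (S.userCov θ k).trace.re ^ 2

/-- `I_k`. -/
def userInterference (θ : Fin N → ℝ) (k : Fin K) : ℝ :=
  S.ξ * S.P * ∑ i ∈ Finset.univ.erase k, (S.userCov θ k * S.userCov θ i).trace.re +
    S.noiseVar k * S.sumTrace θ

/-- `S_E`. -/
def eveSignal (θ : Fin N → ℝ) (k : Fin K) : ℝ :=
  S.ξ * M * ME * ((M : ℝ) - K) *
    (S.userCov θ k * (S.eveCov θ + (S.loss.beta3 : ℂ) • S.RBE)).trace.re

/-- `I_E`. -/
def eveInterference (θ : Fin N → ℝ) : ℝ :=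
  (1 - S.ξ) * ((M : ℝ) - K - ME) *
    (S.eveCov θ + (S.loss.beta3 : ℂ) • S.RBE).trace.re * S.sumTrace θ

/-- `γ_k`. -/
def gammaUser (θ : Fin N → ℝ) (k : Fin K) : ℝ :=
  S.userSignal θ k / S.userInterference θ k

/-- `γ_E` (for the message of user `k`). -/
def gammaEve (θ : Fin N → ℝ) (k : Fin K) : ℝ :=
  S.eveSignal θ k / S.eveInterference θ

/-- The closed-form ergodic secrecy rate of user `k`. -/
def secrecyRate (θ : Fin N → ℝ) (k : Fin K) : ℝ :=
  max 0 (Real.logb 2 (1 + S.gammaUser θ k) - Real.logb 2 (1 + S.gammaEve θ k))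

/-! ### The random channels -/

section Channels

variable {Ω : Type*} (gI : Fin K → Fin N → Ω → ℂ) (gB : Fin K → Fin M → Ω → ℂ)

/-- The channel from the RIS to user `k`. -/
def hI (k : Fin K) (ω : Ω) : Fin N → ℂ :=
  (Real.sqrt (S.loss.betaI k) : ℂ) • (sqrtMatrix (S.RI k) *ᵥ fun n => gI k n ω)

/-- The channel from the base station to user `k`. -/
def hB (k : Fin K) (ω : Ω) : Fin M → ℂ :=
  (Real.sqrt (S.loss.beta2 k) : ℂ) • (sqrtMatrix (S.RB k) *ᵥ fun m => gB k m ω)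

/-- The cascaded channel through the RIS of user `k`. -/
def cascaded (θ : Fin N → ℝ) (k : Fin K) (ω : Ω) : Fin M → ℂ :=
  (S.H1 * phaseMatrix θ) *ᵥ S.hI gI k ω

/-- The equivalent channel from the base station to user `k`. -/
def channel (θ : Fin N → ℝ) (k : Fin K) (ω : Ω) : Fin M → ℂ :=
  S.cascaded gI θ k ω + S.hB gB k ω

/-- The MRT precoding vector of user `k`. -/
def mrt (θ : Fin N → ℝ) (k : Fin K) (ω : Ω) : Fin M → ℂ :=
  (Real.sqrt (K / S.sumTrace θ) : ℂ) • S.channel gI gB θ k ω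

/-- The received amplitude `√p h_k^H w_i` with `p = ξP/K`. -/
def received (θ : Fin N → ℝ) (k i : Fin K) (ω : Ω) : ℂ :=
  (Real.sqrt (S.ξ * S.P / K) : ℂ) * (star (S.channel gI gB θ k ω) ⬝ᵥ S.mrt gI gB θ i ω)

variable [MeasurableSpace Ω] (μ : Measure Ω)

/-- Power of the desired signal of user `k`: `|E{√p h_k^H w_k}|²`. -/
def signalPower (θ : Fin N → ℝ) (k : Fin K) : ℝ :=
  ‖∫ ω, S.received gI gB θ k k ω ∂μ‖ ^ 2

/-- Power of the inter-user interference at user `k`: `∑_{i ≠ k} E{|√p h_k^H w_i|²}`. -/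
def interferencePower (θ : Fin N → ℝ) (k : Fin K) : ℝ :=
  ∑ i ∈ Finset.univ.erase k, ∫ ω, ‖S.received gI gB θ k i ω‖ ^ 2 ∂μ

/-- Mean-square normalized inner product of the cascaded channels `f_k`, `f_i` of two users:
`E{|f_k^H f_i|²} / (E{‖f_k‖²} E{‖f_i‖²})`. Asymptotic orthogonality means that it tends to `0`. -/
def cascadedCoherence (θ : Fin N → ℝ) (k i : Fin K) : ℝ :=
  (∫ ω, ‖star (S.cascaded gI θ k ω) ⬝ᵥ S.cascaded gI θ i ω‖ ^ 2 ∂μ) /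
    ((∫ ω, ∑ m, ‖S.cascaded gI θ k ω m‖ ^ 2 ∂μ) *
      (∫ ω, ∑ m, ‖S.cascaded gI θ i ω m‖ ^ 2 ∂μ))

end Channels

/-! ### The explicit expressions for uncorrelated fading -/

/-- `∑_{i ≠ k} [β_{2,k} β_{2,i} M + (β_{2,k} β_{I,i} + β_{I,k} β_{2,i}) β₁ M N
+ β_{I,k} β_{I,i} ‖H₁ H₁^H‖²]`. -/
def interferenceSum (k : Fin K) : ℝ :=
  ∑ i ∈ Finset.univ.erase k,
    (S.loss.beta2 k * S.loss.beta2 i * M +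
      (S.loss.beta2 k * S.loss.betaI i + S.loss.betaI k * S.loss.beta2 i) *
        S.loss.beta1 * M * N +
      S.loss.betaI k * S.loss.betaI i * frobSq (S.H1 * S.H1ᴴ))

/-- `∑ⱼ [β_{I,j} β₁ M N + β_{2,j} M]`. -/
def gainSum : ℝ :=
  ∑ j, (S.loss.betaI j * S.loss.beta1 * M * N + S.loss.beta2 j * M)

end System

end RIS

end

namespace RIS

/-! ### Phase cancellation and Frobenius norms as traces. -/

section Matrices

/-! Without correlation the phases enter only through `Φ Φᴴ = 1`, so every covariance has the form
`a • 1 + b • (H₁ H₁ᴴ)`. Traces of such matrices and of their products involve only `tr (H₁ H₁ᴴ) =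
β₁MN` (all entries of `H₁` have modulus `√β₁`) and `tr ((H₁ H₁ᴴ)²) = ‖H₁ H₁ᴴ‖²`. This gives the
closed forms and their independence of the phases (`trace_affine`, `trace_affine_mul_affine`).

Interference persists because `‖H₁ H₁ᴴ‖² = ‖H₁ᴴ H₁‖²`, and the `N × N` Gram matrix `H₁ᴴ H₁` has all
diagonal entries equal to `β₁M`; hence `‖H₁ H₁ᴴ‖² ≥ N (β₁M)²` (`frobSq_H1_ge`). Interference thus
grows at least like `M²`, the order of the squared mean gain, and the ratio is bounded below without
`M`.

To connect this with the random channels, each user's channel is written as a fixed matrix `A`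
applied to that user's fading vector `x`. Then `E ‖A x‖² = tr (A Aᴴ)` and, for distinct users, `E
|(A x)ᴴ (B y)|² = tr (A Aᴴ B Bᴴ)`; only zero mean, unit variance and independence are needed. -/

theorem phaseMatrix_mul_conjTranspose {N : ℕ} (θ : Fin N → ℝ) :
    phaseMatrix θ * (phaseMatrix θ)ᴴ = 1 := by
  rw [phaseMatrix, Matrix.diagonal_conjTranspose, Matrix.diagonal_mul_diagonal,
    ← Matrix.diagonal_one]
  congr 1
  funext n
  simp only [Pi.star_apply, RCLike.star_def, Complex.mul_conj, Complex.normSq_eq_norm_sq,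
    mul_comm Complex.I, Complex.norm_exp_ofReal_mul_I]
  norm_num

theorem sqrtMatrix_one (n : ℕ) : sqrtMatrix (1 : Matrix (Fin n) (Fin n) ℂ) = 1 := by
  rw [sqrtMatrix, cfc_apply_one]
  simp

theorem trace_mul_conjTranspose {m n : Type*} [Fintype m] [Fintype n] (A : Matrix m n ℂ) :
    (A * Aᴴ).trace = ((∑ i, ∑ j, ‖A i j‖ ^ 2 : ℝ) : ℂ) := by
  simp only [Matrix.trace, Matrix.diag_apply, Matrix.mul_apply, Matrix.conjTranspose_apply,
    RCLike.star_def, Complex.mul_conj, Complex.normSq_eq_norm_sq]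
  push_cast
  rfl

theorem trace_mul_conjTranspose_eq_frobSq {m n : ℕ} (A : Matrix (Fin m) (Fin n) ℂ) :
    (A * Aᴴ).trace = (frobSq A : ℂ) :=
  trace_mul_conjTranspose A

/-- Both sides are `tr (A Aᴴ A Aᴴ)` up to cyclic rotation. -/
theorem frobSq_mul_conjTranspose_comm {m n : ℕ} (A : Matrix (Fin m) (Fin n) ℂ) :
    frobSq (A * Aᴴ) = frobSq (Aᴴ * A) := by
  have h : ((frobSq (A * Aᴴ) : ℝ) : ℂ) = (frobSq (Aᴴ * A) : ℝ) := by
    rw [← trace_mul_conjTranspose_eq_frobSq, ← trace_mul_conjTranspose_eq_frobSq,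
      Matrix.conjTranspose_mul, Matrix.conjTranspose_mul, Matrix.conjTranspose_conjTranspose,
      Matrix.mul_assoc, Matrix.trace_mul_comm, Matrix.mul_assoc Aᴴ A]
    simp only [Matrix.mul_assoc]
  exact_mod_cast h

theorem frobSq_nonneg {m n : ℕ} (A : Matrix (Fin m) (Fin n) ℂ) : 0 ≤ frobSq A :=
  Finset.sum_nonneg fun _ _ => Finset.sum_nonneg fun _ _ => by positivity

end Matrices

/-! ### Covariances and closed forms under uncorrelated fading. -/

namespace System

variable {K M N ME : ℕ} (S : System K M N ME)

theorem norm_H1_sq (m : Fin M) (n : Fin N) : ‖S.H1 m n‖ ^ 2 = S.loss.beta1 := by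
  have h : ∀ x : ℝ, ‖Complex.exp (-(Complex.I * (x : ℂ)))‖ = 1 := fun x => by
    rw [← mul_neg, mul_comm, ← Complex.ofReal_neg, Complex.norm_exp_ofReal_mul_I]
  rw [H1, Matrix.of_apply, norm_mul, h, mul_one, Complex.norm_real, Real.norm_eq_abs, sq_abs,
    Real.sq_sqrt S.loss.beta1_pos.le]

theorem trace_H1 : (S.H1 * S.H1ᴴ).trace = ((S.loss.beta1 * M * N : ℝ) : ℂ) := by
  rw [trace_mul_conjTranspose]
  simp only [norm_H1_sq, Finset.sum_const, Finset.card_univ, Fintype.card_fin, nsmul_eq_mul]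
  congr 1
  ring

/-- Pass to the Gram matrix of the columns and discard its off-diagonal entries; the `N` diagonal
ones are the squared column norms `β₁M`. -/
theorem frobSq_H1_ge : N * (S.loss.beta1 * M) ^ 2 ≤ frobSq (S.H1 * S.H1ᴴ) := by
  rw [frobSq_mul_conjTranspose_comm, frobSq]
  have h : ∀ n, ‖(S.H1ᴴ * S.H1) n n‖ = S.loss.beta1 * M := fun n => by
    have : (S.H1ᴴ * S.H1) n n = ((S.loss.beta1 * M : ℝ) : ℂ) := by
      simp only [Matrix.mul_apply, Matrix.conjTranspose_apply, RCLike.star_def, Complex.conj_mul',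
        ← Complex.ofReal_pow, norm_H1_sq]
      simp [mul_comm]
    rw [this, Complex.norm_real, Real.norm_of_nonneg]
    have := S.loss.beta1_pos
    positivity
  calc (N : ℝ) * (S.loss.beta1 * M) ^ 2
      = ∑ n, ‖(S.H1ᴴ * S.H1) n n‖ ^ 2 := by simp [h]
    _ ≤ _ := Finset.sum_le_sum fun n _ => Finset.single_le_sum
        (f := fun j => ‖(S.H1ᴴ * S.H1) n j‖ ^ 2) (fun _ _ => by positivity) (Finset.mem_univ n)

theorem trace_affine (a b : ℝ) :
    ((a : ℂ) • (1 : Matrix (Fin M) (Fin M) ℂ) + (b : ℂ) • (S.H1 * S.H1ᴴ)).trace =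
      ((b * S.loss.beta1 * M * N + a * M : ℝ) : ℂ) := by
  rw [Matrix.trace_add, Matrix.trace_smul, Matrix.trace_smul, trace_H1, Matrix.trace_one]
  simp
  ring

theorem trace_affine_mul_affine (a b c d : ℝ) :
    (((a : ℂ) • (1 : Matrix (Fin M) (Fin M) ℂ) + (b : ℂ) • (S.H1 * S.H1ᴴ)) *
      ((c : ℂ) • (1 : Matrix (Fin M) (Fin M) ℂ) + (d : ℂ) • (S.H1 * S.H1ᴴ))).trace =
      ((a * c * M + (a * d + b * c) * S.loss.beta1 * M * N +
        b * d * frobSq (S.H1 * S.H1ᴴ) : ℝ) : ℂ) := by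
  have h := trace_mul_conjTranspose_eq_frobSq (S.H1 * S.H1ᴴ)
  rw [Matrix.conjTranspose_mul, Matrix.conjTranspose_conjTranspose] at h
  simp only [add_mul, mul_add, Matrix.smul_mul, Matrix.mul_smul, Matrix.one_mul, Matrix.mul_one,
    Matrix.trace_add, Matrix.trace_smul, trace_H1, h, Matrix.trace_one, smul_eq_mul,
    Fintype.card_fin]
  push_cast
  ring

theorem mul_phaseMatrix_mul_conjTranspose (θ : Fin N → ℝ) :
    S.H1 * phaseMatrix θ * (1 : Matrix (Fin N) (Fin N) ℂ) * (phaseMatrix θ)ᴴ * S.H1ᴴ =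
      S.H1 * S.H1ᴴ := by
  rw [Matrix.mul_one, Matrix.mul_assoc S.H1, phaseMatrix_mul_conjTranspose, Matrix.mul_one]

variable {S} (hS : S.IsUncorrelated)
include hS

theorem IsUncorrelated.userCov_eq (θ : Fin N → ℝ) (k : Fin K) :
    S.userCov θ k = (S.loss.beta2 k : ℂ) • (1 : Matrix (Fin M) (Fin M) ℂ) +
      (S.loss.betaI k : ℂ) • (S.H1 * S.H1ᴴ) := by
  rw [userCov, hS.1, hS.2.1, mul_phaseMatrix_mul_conjTranspose]

theorem IsUncorrelated.eveCov_add_eq (θ : Fin N → ℝ) :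
    S.eveCov θ + (S.loss.beta3 : ℂ) • S.RBE =
      (S.loss.beta3 : ℂ) • (1 : Matrix (Fin M) (Fin M) ℂ) +
      (S.loss.betaIE : ℂ) • (S.H1 * S.H1ᴴ) := by
  rw [eveCov, hS.2.2.1, hS.2.2.2, mul_phaseMatrix_mul_conjTranspose, add_comm]

theorem IsUncorrelated.sumTrace_eq (θ : Fin N → ℝ) : S.sumTrace θ = S.gainSum := by
  simp only [sumTrace, gainSum, hS.userCov_eq, trace_affine, Complex.ofReal_re]

theorem IsUncorrelated.sum_trace_mul_eq (θ : Fin N → ℝ) (k : Fin K) :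
    ∑ i ∈ Finset.univ.erase k, (S.userCov θ k * S.userCov θ i).trace.re = S.interferenceSum k := by
  simp only [interferenceSum, hS.userCov_eq, trace_affine_mul_affine, Complex.ofReal_re]

theorem IsUncorrelated.gammaUser_eq (θ : Fin N → ℝ) (k : Fin K) :
    S.gammaUser θ k =
      S.ξ * S.P * (S.loss.betaI k * S.loss.beta1 * M * N + S.loss.beta2 k * M) ^ 2 /
        (S.ξ * S.P * S.interferenceSum k + S.noiseVar k * S.gainSum) := by
  rw [gammaUser, userSignal, userInterference, hS.sum_trace_mul_eq, hS.sumTrace_eq,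
    hS.userCov_eq, trace_affine, Complex.ofReal_re]

theorem IsUncorrelated.gammaEve_eq (θ : Fin N → ℝ) (k : Fin K) :
    S.gammaEve θ k =
      S.ξ * ME * ((M : ℝ) - K) *
        (S.loss.betaI k * S.loss.betaIE * frobSq (S.H1 * S.H1ᴴ) +
          (S.loss.betaI k * S.loss.beta3 + S.loss.beta2 k * S.loss.betaIE) *
            S.loss.beta1 * M * N +
          S.loss.beta2 k * S.loss.beta3 * M) /
        ((1 - S.ξ) * ((M : ℝ) - K - ME) * (S.loss.beta3 + S.loss.betaIE * S.loss.beta1 * N) *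
          S.gainSum) := by
  have hM : (M : ℝ) ≠ 0 := by
    have := S.antennas
    exact_mod_cast (by omega : M ≠ 0)
  rw [gammaEve, eveSignal, eveInterference, hS.sumTrace_eq, hS.eveCov_add_eq, hS.userCov_eq,
    trace_affine, trace_affine_mul_affine, Complex.ofReal_re, Complex.ofReal_re]
  -- The explicit factor `M` of the numerator cancels against the one in `tr (R_E + β₃ 1) = M (β₃ +
  -- β_IE β₁ N)`.
  refine Eq.trans ?_ (mul_div_mul_left _ _ hM)
  congr 1 <;> ring

theorem IsUncorrelated.secrecyRate_eq (θ θ' : Fin N → ℝ) (k : Fin K) :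
    S.secrecyRate θ k = S.secrecyRate θ' k := by
  simp only [secrecyRate, hS.gammaUser_eq, hS.gammaEve_eq]

end System

/-! ### Second moments of independent `CN(0, 1)` coefficients and of their sesquilinear forms. -/

section Moments

instance : IsProbabilityMeasure stdComplexGaussian :=
  Measure.isProbabilityMeasure_map (by fun_prop)

theorem memLp_id_stdComplexGaussian : MemLp id 2 stdComplexGaussian := by
  have h : MemLp (id : ℝ → ℝ) 2 (gaussianReal 0 (1 / 2)) := by
    simpa using memLp_id_gaussianReal (μ := 0) (v := 1 / 2) 2
  rw [stdComplexGaussian, memLp_map_measure_iff (by fun_prop) (by fun_prop)]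
  have h1 : MemLp (fun z : ℝ × ℝ => (z.1 : ℂ)) 2
      ((gaussianReal 0 (1 / 2)).prod (gaussianReal 0 (1 / 2))) :=
    (h.comp_measurePreserving measurePreserving_fst).ofReal
  have h2 : MemLp (fun z : ℝ × ℝ => (z.2 : ℂ)) 2
      ((gaussianReal 0 (1 / 2)).prod (gaussianReal 0 (1 / 2))) :=
    (h.comp_measurePreserving measurePreserving_snd).ofReal
  exact h1.add (h2.mul_const Complex.I)

theorem integral_id_stdComplexGaussian : ∫ z, z ∂stdComplexGaussian = 0 := by
  have h : Integrable (id : ℝ → ℝ) (gaussianReal 0 (1 / 2)) := by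
    have := memLp_id_gaussianReal (μ := 0) (v := 1 / 2) 1
    simpa using memLp_one_iff_integrable.1 (by simpa using this)
  rw [stdComplexGaussian, integral_map (by fun_prop) (by fun_prop), integral_add,
    integral_mul_const, integral_fun_fst (f := fun x : ℝ => (x : ℂ)),
    integral_fun_snd (f := fun x : ℝ => (x : ℂ)), integral_complex_ofReal, integral_id_gaussianReal]
  · simp
  · exact (h.comp_fst _).ofReal
  · exact (h.comp_snd _).ofReal.mul_const _

theorem integral_sq_gaussianReal (v : NNReal) : ∫ x, x ^ 2 ∂gaussianReal 0 v = v := by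
  have h := variance_fun_id_gaussianReal (μ := 0) (v := v)
  rwa [variance_of_integral_eq_zero (by fun_prop) integral_id_gaussianReal] at h

theorem integral_norm_sq_stdComplexGaussian : ∫ z, ‖z‖ ^ 2 ∂stdComplexGaussian = 1 := by
  have h : Integrable (fun x : ℝ => x ^ 2) (gaussianReal 0 (1 / 2)) := by
    have := (memLp_id_gaussianReal (μ := 0) (v := 1 / 2) 2)
    exact MemLp.integrable_sq this
  have e : ∀ z : ℝ × ℝ, ‖(z.1 : ℂ) + (z.2 : ℂ) * Complex.I‖ ^ 2 = z.1 ^ 2 + z.2 ^ 2 := fun z => by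
    rw [← Complex.normSq_eq_norm_sq, Complex.normSq_add_mul_I]
  rw [stdComplexGaussian, integral_map (by fun_prop) (by fun_prop)]
  simp only [e]
  rw [integral_add (h.comp_fst _) (h.comp_snd _), integral_fun_fst (f := fun x : ℝ => x ^ 2),
    integral_fun_snd (f := fun x : ℝ => x ^ 2), integral_sq_gaussianReal]
  simp
  norm_num

variable {Ω ι κ : Type*} [MeasurableSpace Ω] {μ : Measure Ω}

theorem memLp_of_hasLaw_stdComplexGaussian {X : Ω → ℂ} (h : HasLaw X stdComplexGaussian μ) :
    MemLp X 2 μ := by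
  have := memLp_id_stdComplexGaussian
  rw [← h.map_eq, memLp_map_measure_iff (by fun_prop) h.aemeasurable] at this
  exact this

theorem integrable_mul_star {X Y : Ω → ℂ} (hX : HasLaw X stdComplexGaussian μ)
    (hY : HasLaw Y stdComplexGaussian μ) : Integrable (fun ω => X ω * star (Y ω)) μ :=
  (memLp_of_hasLaw_stdComplexGaussian hX).integrable_mul
    (memLp_of_hasLaw_stdComplexGaussian hY).star

/-- Orthonormality in `L²`: for distinct indices independence factors the expectation, and the mean
is zero. -/
theorem integral_mul_star [DecidableEq ι] {g : ι → Ω → ℂ}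
    (hl : ∀ a, HasLaw (g a) stdComplexGaussian μ) (hi : iIndepFun g μ) (a b : ι) :
    ∫ ω, g a ω * star (g b ω) ∂μ = if a = b then 1 else 0 := by
  split_ifs with h
  · subst h
    have := (hl a).integral_comp (f := fun z : ℂ => ‖z‖ ^ 2) (by fun_prop)
    rw [integral_norm_sq_stdComplexGaussian] at this
    simp only [RCLike.star_def, Complex.mul_conj', ← Complex.ofReal_pow]
    rw [integral_complex_ofReal, ← Complex.ofReal_one, ← this]
    rfl
  · have hs : AEMeasurable (fun ω => star (g b ω)) μ := by
      have := (hl b).aemeasurable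
      fun_prop
    have hind : IndepFun (g a) (fun ω => star (g b ω)) μ :=
      (hi.indepFun h).comp (φ := id) (ψ := star) measurable_id (by fun_prop)
    rw [hind.integral_fun_mul_eq_mul_integral (hl a).aemeasurable.aestronglyMeasurable
      hs.aestronglyMeasurable, (hl a).integral_eq, integral_id_stdComplexGaussian, zero_mul]

variable [Fintype ι]

theorem integral_star_mulVec_dotProduct_self [DecidableEq ι] {m : Type*} [Fintype m]
    {x : ι → Ω → ℂ} (hl : ∀ a, HasLaw (x a) stdComplexGaussian μ) (hi : iIndepFun x μ)
    (A : Matrix m ι ℂ) :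
    ∫ ω, star (A *ᵥ fun a => x a ω) ⬝ᵥ (A *ᵥ fun a => x a ω) ∂μ = (A * Aᴴ).trace := by
  have e : ∀ ω, star (A *ᵥ fun a => x a ω) ⬝ᵥ (A *ᵥ fun a => x a ω) =
      ∑ i, ∑ b, ∑ a, star (A i b) * A i a * (x a ω * star (x b ω)) := fun ω => by
    simp only [dotProduct, Matrix.mulVec, Pi.star_apply, star_sum, Finset.sum_mul_sum, star_mul']
    refine Finset.sum_congr rfl fun i _ => Finset.sum_congr rfl fun b _ =>
      Finset.sum_congr rfl fun a _ => by ring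
  simp only [e]
  have hint : ∀ a b, Integrable (fun ω => x a ω * star (x b ω)) μ :=
    fun a b => integrable_mul_star (hl a) (hl b)
  rw [integral_finsetSum _ fun i _ => integrable_finsetSum _ fun b _ =>
    integrable_finsetSum _ fun a _ => (hint a b).const_mul _]
  simp only [Matrix.trace, Matrix.diag_apply, Matrix.mul_apply, Matrix.conjTranspose_apply]
  refine Finset.sum_congr rfl fun i _ => ?_
  rw [integral_finsetSum _ fun b _ => integrable_finsetSum _ fun a _ => (hint a b).const_mul _]
  refine Finset.sum_congr rfl fun b _ => ?_
  rw [integral_finsetSum _ fun a _ => (hint a b).const_mul _]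
  simp only [integral_const_mul, integral_mul_star hl hi]
  simp [mul_comm]

/-- Expanding the square gives products of a pair of coefficients of `k` and a pair of `i`. These
pairs are independent, so each expectation factors into two covariances and no fourth moment of a
single coefficient appears. -/
theorem integral_norm_sq_sesquilinear [DecidableEq κ] [DecidableEq ι] {g : κ × ι → Ω → ℂ}
    (hl : ∀ p, HasLaw (g p) stdComplexGaussian μ) (hi : iIndepFun g μ) {k i : κ} (hki : k ≠ i)
    (c : ι → ι → ℂ) :
    ∫ ω, ‖∑ a, ∑ b, c a b * (star (g (k, a) ω) * g (i, b) ω)‖ ^ 2 ∂μ =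
      ∑ a, ∑ b, ‖c a b‖ ^ 2 := by
  have key : ∀ a a' b b' : ι,
      Integrable (fun ω => (g (k, a') ω * star (g (k, a) ω)) *
        (g (i, b) ω * star (g (i, b') ω))) μ ∧
      ∫ ω, (g (k, a') ω * star (g (k, a) ω)) * (g (i, b) ω * star (g (i, b') ω)) ∂μ =
        if a' = a then if b = b' then 1 else 0 else 0 := by
    intro a a' b b'
    have hx := integrable_mul_star (hl (k, a')) (hl (k, a))
    have hy := integrable_mul_star (hl (i, b)) (hl (i, b'))
    have hind : IndepFun (fun ω => g (k, a') ω * star (g (k, a) ω))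
        (fun ω => g (i, b) ω * star (g (i, b') ω)) μ :=
      -- The indices within a pair may coincide; independence needs only that the two pairs are
      -- disjoint, which `k ≠ i` ensures.
      (hi.indepFun_prodMk_prodMk₀ (fun p => (hl p).aemeasurable) (k, a') (k, a) (i, b) (i, b')
        (by simp [hki]) (by simp [hki]) (by simp [hki]) (by simp [hki])).comp
        (φ := fun z : ℂ × ℂ => z.1 * star z.2) (ψ := fun z : ℂ × ℂ => z.1 * star z.2)
        (by fun_prop) (by fun_prop)
    refine ⟨hind.integrable_mul hx hy, ?_⟩
    rw [hind.integral_fun_mul_eq_mul_integral hx.aestronglyMeasurable hy.aestronglyMeasurable,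
      integral_mul_star hl hi, integral_mul_star hl hi]
    split_ifs <;> simp_all
  have e : ∀ ω, ((‖∑ a, ∑ b, c a b * (star (g (k, a) ω) * g (i, b) ω)‖ ^ 2 : ℝ) : ℂ) =
      ∑ a, ∑ a', ∑ b, ∑ b', c a b * star (c a' b') *
        ((g (k, a') ω * star (g (k, a) ω)) * (g (i, b) ω * star (g (i, b') ω))) := fun ω => by
    rw [Complex.ofReal_pow, ← Complex.mul_conj', ← RCLike.star_def]
    simp only [star_sum, Finset.sum_mul_sum, star_mul', star_star]
    refine Finset.sum_congr rfl fun a _ => Finset.sum_congr rfl fun a' _ =>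
      Finset.sum_congr rfl fun b _ => Finset.sum_congr rfl fun b' _ => by ring
  have h : ((∫ ω, ‖∑ a, ∑ b, c a b * (star (g (k, a) ω) * g (i, b) ω)‖ ^ 2 ∂μ : ℝ) : ℂ) =
      ((∑ a, ∑ b, ‖c a b‖ ^ 2 : ℝ) : ℂ) := by
    rw [← integral_complex_ofReal]
    simp only [e]
    have hI := fun a a' b b' => (key a a' b b').1.const_mul (c a b * star (c a' b'))
    rw [integral_finsetSum _ fun a _ => integrable_finsetSum _ fun a' _ =>
      integrable_finsetSum _ fun b _ => integrable_finsetSum _ fun b' _ => hI a a' b b',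
      Complex.ofReal_sum]
    refine Finset.sum_congr rfl fun a _ => ?_
    rw [integral_finsetSum _ fun a' _ =>
      integrable_finsetSum _ fun b _ => integrable_finsetSum _ fun b' _ => hI a a' b b']
    have : ∀ a', ∫ ω, ∑ b, ∑ b', c a b * star (c a' b') *
        ((g (k, a') ω * star (g (k, a) ω)) * (g (i, b) ω * star (g (i, b') ω))) ∂μ =
        if a' = a then ((∑ b, ‖c a b‖ ^ 2 : ℝ) : ℂ) else 0 := by
      intro a'
      rw [integral_finsetSum _ fun b _ => integrable_finsetSum _ fun b' _ => hI a a' b b']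
      have : ∀ b, ∫ ω, ∑ b', c a b * star (c a' b') *
        ((g (k, a') ω * star (g (k, a) ω)) * (g (i, b) ω * star (g (i, b') ω))) ∂μ =
          if a' = a then ((‖c a b‖ ^ 2 : ℝ) : ℂ) else 0 := by
        intro b
        rw [integral_finsetSum _ fun b' _ => hI a a' b b']
        simp only [integral_const_mul, (key _ _ _ _).2]
        split_ifs with h
        · subst h
          simp [Complex.mul_conj']
        · simp
      simp only [this]
      split_ifs <;> simp
    simp only [this]
    simp
  exact_mod_cast h

/-- The inner product is a sesquilinear form with coefficient matrix `Aᴴ * B`, whose squared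
Frobenius norm is this trace by cyclicity. -/
theorem integral_norm_sq_mulVec_dotProduct [DecidableEq κ] [DecidableEq ι] {m : Type*} [Fintype m]
    {g : κ × ι → Ω → ℂ} (hl : ∀ p, HasLaw (g p) stdComplexGaussian μ) (hi : iIndepFun g μ)
    {k i : κ} (hki : k ≠ i) (A B : Matrix m ι ℂ) :
    ∫ ω, ‖star (A *ᵥ fun a => g (k, a) ω) ⬝ᵥ (B *ᵥ fun a => g (i, a) ω)‖ ^ 2 ∂μ =
      ((A * Aᴴ) * (B * Bᴴ)).trace.re := by
  have e : ∀ x y : ι → ℂ, star (A *ᵥ x) ⬝ᵥ (B *ᵥ y) =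
      ∑ a, ∑ b, (Aᴴ * B) a b * (star (x a) * y b) := fun x y => by
    rw [Matrix.star_mulVec, ← Matrix.dotProduct_mulVec, Matrix.mulVec_mulVec]
    simp only [dotProduct, Matrix.mulVec, Finset.mul_sum, Pi.star_apply]
    refine Finset.sum_congr rfl fun a _ => Finset.sum_congr rfl fun b _ => by ring
  simp only [e]
  have t := congrArg Complex.re (trace_mul_conjTranspose (Aᴴ * B))
  rw [Complex.ofReal_re, Matrix.conjTranspose_mul, Matrix.conjTranspose_conjTranspose,
    Matrix.mul_assoc, Matrix.trace_mul_comm, ← Matrix.mul_assoc, Matrix.mul_assoc,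
    Matrix.trace_mul_comm] at t
  rw [integral_norm_sq_sesquilinear hl hi hki (fun a b => (Aᴴ * B) a b), t]

end Moments

/-! ### The random channels as linear images of the fading, and their powers. -/

namespace System

variable {K M N ME : ℕ} (S : System K M N ME)

/-- The matrix that maps the fading coefficients of user `k` to its channel, when the amplitude of
the direct path is `b`. -/
noncomputable def mixing (θ : Fin N → ℝ) (k : Fin K) (b : ℝ) : Matrix (Fin M) (Fin N ⊕ Fin M) ℂ :=
  Matrix.fromCols ((Real.sqrt (S.loss.betaI k) : ℂ) • (S.H1 * phaseMatrix θ)) ((b : ℂ) • 1)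

/-- The RIS block and the direct block contribute separately, and the phases cancel in the former.
Taking `b = 0` gives the cascaded channel, `b = √β₂` the full channel. -/
theorem mixing_mul_conjTranspose (θ : Fin N → ℝ) (k : Fin K) (b : ℝ) :
    S.mixing θ k b * (S.mixing θ k b)ᴴ =
      ((b ^ 2 : ℝ) : ℂ) • (1 : Matrix (Fin M) (Fin M) ℂ) +
        (S.loss.betaI k : ℂ) • (S.H1 * S.H1ᴴ) := by
  have h := S.mul_phaseMatrix_mul_conjTranspose θ
  rw [Matrix.mul_one, Matrix.mul_assoc _ (phaseMatrix θ)ᴴ, ← Matrix.conjTranspose_mul] at h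
  have hs : (Real.sqrt (S.loss.betaI k) : ℂ) * (Real.sqrt (S.loss.betaI k) : ℂ) =
      (S.loss.betaI k : ℂ) := by
    rw [← Complex.ofReal_mul, Real.mul_self_sqrt (S.loss.betaI_pos k).le]
  rw [mixing, Matrix.conjTranspose_fromCols_eq_fromRows_conjTranspose,
    Matrix.fromCols_mul_fromRows]
  simp only [Matrix.conjTranspose_smul, Matrix.smul_mul, Matrix.mul_smul, smul_smul, h,
    RCLike.star_def, Complex.conj_ofReal, hs, Matrix.conjTranspose_one, Matrix.mul_one]
  rw [add_comm, ← Complex.ofReal_mul, sq]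

/-- All fading coefficients as one family. -/
def fading {Ω : Type*} (gI : Fin K → Fin N → Ω → ℂ) (gB : Fin K → Fin M → Ω → ℂ)
    (p : Fin K × (Fin N ⊕ Fin M)) : Ω → ℂ :=
  Sum.elim (gI p.1) (gB p.1) p.2

variable {S} (hS : S.IsUncorrelated) {Ω : Type*} (gI : Fin K → Fin N → Ω → ℂ)
  (gB : Fin K → Fin M → Ω → ℂ)
include hS

theorem IsUncorrelated.cascaded_eq (θ : Fin N → ℝ) (k : Fin K) (ω : Ω) :
    S.cascaded gI θ k ω = S.mixing θ k 0 *ᵥ fun a => fading gI gB (k, a) ω := by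
  have : (fun a => fading gI gB (k, a) ω) =
      Sum.elim (fun n => gI k n ω) (fun m => gB k m ω) := by
    ext a; cases a <;> rfl
  rw [this, mixing, Matrix.fromCols_mulVec_sumElim, cascaded, hI, hS.1, sqrtMatrix_one]
  simp [Matrix.mulVec_smul, Matrix.smul_mulVec]

theorem IsUncorrelated.channel_eq (θ : Fin N → ℝ) (k : Fin K) (ω : Ω) :
    S.channel gI gB θ k ω =
      S.mixing θ k (Real.sqrt (S.loss.beta2 k)) *ᵥ fun a => fading gI gB (k, a) ω := by
  have : (fun a => fading gI gB (k, a) ω) =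
      Sum.elim (fun n => gI k n ω) (fun m => gB k m ω) := by
    ext a; cases a <;> rfl
  rw [this, mixing, Matrix.fromCols_mulVec_sumElim, channel, cascaded, hI, hB, hS.1, hS.2.1,
    sqrtMatrix_one, sqrtMatrix_one]
  simp [Matrix.mulVec_smul, Matrix.smul_mulVec]

variable {gI gB} [MeasurableSpace Ω] {μ : Measure Ω} (hg : IsFading μ gI gB)
include hg

omit hS in
theorem hasLaw_fading (p : Fin K × (Fin N ⊕ Fin M)) :
    HasLaw (fading gI gB p) stdComplexGaussian μ := by
  obtain ⟨k, n | m⟩ := p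
  exacts [hg.law_I k n, hg.law_B k m]

omit hS in
theorem iIndepFun_fading_user (k : Fin K) :
    iIndepFun (fun a => fading gI gB (k, a)) μ :=
  iIndepFun.precomp (g := fun a => (k, a)) (fun _ _ h => (Prod.mk.inj h).2) hg.indep

theorem IsUncorrelated.integral_cascaded (θ : Fin N → ℝ) (k : Fin K) :
    ∫ ω, ∑ m, ‖S.cascaded gI θ k ω m‖ ^ 2 ∂μ = S.loss.betaI k * S.loss.beta1 * M * N := by
  have h := integral_star_mulVec_dotProduct_self (fun a => hasLaw_fading hg (k, a))
    (iIndepFun_fading_user hg k) (S.mixing θ k 0)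
  rw [mixing_mul_conjTranspose, trace_affine] at h
  have e : ∀ x : Fin M → ℂ, star x ⬝ᵥ x = ((∑ m, ‖x m‖ ^ 2 : ℝ) : ℂ) := fun x => by
    simp [dotProduct, Complex.conj_mul']
  simp only [← hS.cascaded_eq, e] at h
  rw [integral_complex_ofReal] at h
  simpa using Complex.ofReal_injective h

theorem IsUncorrelated.integral_cascaded_inner (θ : Fin N → ℝ) {k i : Fin K} (hki : k ≠ i) :
    ∫ ω, ‖star (S.cascaded gI θ k ω) ⬝ᵥ S.cascaded gI θ i ω‖ ^ 2 ∂μ =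
      S.loss.betaI k * S.loss.betaI i * frobSq (S.H1 * S.H1ᴴ) := by
  simp only [hS.cascaded_eq gI gB]
  rw [integral_norm_sq_mulVec_dotProduct (hasLaw_fading hg) hg.indep hki,
    mixing_mul_conjTranspose, mixing_mul_conjTranspose, trace_affine_mul_affine,
    Complex.ofReal_re]
  ring

theorem IsUncorrelated.cascadedCoherence_eq (θ : Fin N → ℝ) {k i : Fin K} (hki : k ≠ i) :
    S.cascadedCoherence gI μ θ k i = frobSq (S.H1 * S.H1ᴴ) / (S.loss.beta1 * M * N) ^ 2 := by
  rw [cascadedCoherence, hS.integral_cascaded hg, hS.integral_cascaded hg,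
    hS.integral_cascaded_inner hg θ hki]
  refine Eq.trans ?_ (mul_div_mul_left _ _
    (mul_pos (S.loss.betaI_pos k) (S.loss.betaI_pos i)).ne')
  congr 1
  ring

theorem IsUncorrelated.integral_channel (θ : Fin N → ℝ) (k : Fin K) :
    ∫ ω, star (S.channel gI gB θ k ω) ⬝ᵥ S.channel gI gB θ k ω ∂μ =
      ((S.loss.betaI k * S.loss.beta1 * M * N + S.loss.beta2 k * M : ℝ) : ℂ) := by
  simp only [hS.channel_eq]
  rw [integral_star_mulVec_dotProduct_self (fun a => hasLaw_fading hg (k, a))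
    (iIndepFun_fading_user hg k), mixing_mul_conjTranspose, trace_affine,
    Real.sq_sqrt (S.loss.beta2_pos k).le]

theorem IsUncorrelated.integral_channel_inner (θ : Fin N → ℝ) {k i : Fin K} (hki : k ≠ i) :
    ∫ ω, ‖star (S.channel gI gB θ k ω) ⬝ᵥ S.channel gI gB θ i ω‖ ^ 2 ∂μ =
      S.loss.beta2 k * S.loss.beta2 i * M +
      (S.loss.beta2 k * S.loss.betaI i + S.loss.betaI k * S.loss.beta2 i) *
        S.loss.beta1 * M * N +
      S.loss.betaI k * S.loss.betaI i * frobSq (S.H1 * S.H1ᴴ) := by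
  simp only [hS.channel_eq]
  rw [integral_norm_sq_mulVec_dotProduct (hasLaw_fading hg) hg.indep hki,
    mixing_mul_conjTranspose, mixing_mul_conjTranspose, trace_affine_mul_affine,
    Complex.ofReal_re, Real.sq_sqrt (S.loss.beta2_pos k).le, Real.sq_sqrt (S.loss.beta2_pos i).le]

omit hS hg in
theorem gainSum_pos (k : Fin K) : 0 < S.gainSum := by
  have hM : 0 < M := by have := S.antennas; omega
  refine Finset.sum_pos (fun j _ => ?_) ⟨k, Finset.mem_univ k⟩
  have := S.loss.betaI_pos j
  have := S.loss.beta2_pos j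
  have := S.loss.beta1_pos
  positivity

omit hS hg in
-- The `K` in the power per user cancels the `K` in the precoder normalization; `k` serves to show
-- `K ≠ 0`.
theorem power_scaling (k : Fin K) :
    Real.sqrt (S.ξ * S.P / K) ^ 2 * Real.sqrt (K / S.gainSum) ^ 2 = S.ξ * S.P / S.gainSum := by
  have := S.ξ_nonneg
  have := S.P_pos
  have := gainSum_pos (S := S) k
  have hK : (K : ℝ) ≠ 0 := by exact_mod_cast (Fin.pos k).ne'
  rw [Real.sq_sqrt (by positivity), Real.sq_sqrt (by positivity)]
  field_simp

omit hg [MeasurableSpace Ω] in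
theorem IsUncorrelated.received_eq (θ : Fin N → ℝ) (k i : Fin K) (ω : Ω) :
    S.received gI gB θ k i ω =
      ((Real.sqrt (S.ξ * S.P / K) * Real.sqrt (K / S.gainSum) : ℝ) : ℂ) *
        (star (S.channel gI gB θ k ω) ⬝ᵥ S.channel gI gB θ i ω) := by
  rw [received, mrt, hS.sumTrace_eq, dotProduct_smul, smul_eq_mul, ← mul_assoc,
    Complex.ofReal_mul]

theorem IsUncorrelated.signalPower_eq (θ : Fin N → ℝ) (k : Fin K) :
    S.signalPower gI gB μ θ k = S.ξ * S.P *
      (S.loss.betaI k * S.loss.beta1 * M * N + S.loss.beta2 k * M) ^ 2 / S.gainSum := by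
  simp only [signalPower, hS.received_eq]
  rw [integral_const_mul, hS.integral_channel hg, norm_mul, Complex.norm_real, Complex.norm_real,
    mul_pow, Real.norm_eq_abs, Real.norm_eq_abs, sq_abs, sq_abs, mul_pow, power_scaling k]
  ring

theorem IsUncorrelated.interferencePower_eq (θ : Fin N → ℝ) (k : Fin K) :
    S.interferencePower gI gB μ θ k = S.ξ * S.P * S.interferenceSum k / S.gainSum := by
  have h : ∀ i ∈ Finset.univ.erase k, ∫ ω, ‖S.received gI gB θ k i ω‖ ^ 2 ∂μ =
      S.ξ * S.P / S.gainSum * (S.loss.beta2 k * S.loss.beta2 i * M +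
      (S.loss.beta2 k * S.loss.betaI i + S.loss.betaI k * S.loss.beta2 i) *
        S.loss.beta1 * M * N +
      S.loss.betaI k * S.loss.betaI i * frobSq (S.H1 * S.H1ᴴ)) := by
    intro i hi
    simp only [hS.received_eq, norm_mul, Complex.norm_real, mul_pow, Real.norm_eq_abs, sq_abs]
    rw [integral_const_mul, hS.integral_channel_inner hg θ (Finset.ne_of_mem_erase hi).symm,
      power_scaling k]
  rw [interferencePower, Finset.sum_congr rfl h, ← Finset.mul_sum, interferenceSum]
  ring

omit hS hg in
-- All summands are nonnegative: keep user `i` alone, and of its summand only the term where both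
-- channels pass through the RIS.
theorem le_interferenceSum {k i : Fin K} (hki : i ≠ k) :
    S.loss.betaI k * S.loss.betaI i * (N * (S.loss.beta1 * M) ^ 2) ≤ S.interferenceSum k := by
  have h1 := S.loss.beta1_pos
  have hI := S.loss.betaI_pos
  have h2 := S.loss.beta2_pos
  have hF := frobSq_nonneg (S.H1 * S.H1ᴴ)
  have hnn : ∀ j, 0 ≤ S.loss.beta2 k * S.loss.beta2 j * M +
      (S.loss.beta2 k * S.loss.betaI j + S.loss.betaI k * S.loss.beta2 j) *
        S.loss.beta1 * M * N := fun j => by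
    have := hI k; have := hI j; have := h2 k; have := h2 j
    positivity
  have hp : ∀ j, 0 < S.loss.betaI k * S.loss.betaI j := fun j => mul_pos (hI k) (hI j)
  refine le_trans ?_ (Finset.single_le_sum (fun j _ => add_nonneg (hnn j)
    (mul_nonneg (hp j).le hF)) (Finset.mem_erase.2 ⟨hki, Finset.mem_univ i⟩))
  exact le_add_of_nonneg_of_le (hnn i) (mul_le_mul_of_nonneg_left S.frobSq_H1_ge (hp i).le)

end System

/-! ### A bound on interference over signal that is uniform in `M`. -/

namespace PathLoss

variable {K : ℕ} (L : PathLoss K)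

/-- A lower bound on the interference-to-signal ratio of user `k` caused by user `i`. -/
noncomputable def interferenceRatio (N : ℕ) (k i : Fin K) : ℝ :=
  L.betaI k * L.betaI i * N * L.beta1 ^ 2 / (L.betaI k * L.beta1 * N + L.beta2 k) ^ 2

theorem interferenceRatio_pos {N : ℕ} (hN : 1 ≤ N) (k i : Fin K) :
    0 < L.interferenceRatio N k i := by
  have := L.betaI_pos k
  have := L.betaI_pos i
  have := L.beta2_pos k
  have := L.beta1_pos
  have : (0 : ℝ) < N := by exact_mod_cast hN
  unfold interferenceRatio
  positivity

end PathLoss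

/-- The squared gain is `M² (β_I β₁ N + β₂)²`, so the product with the ratio is exactly the lower
bound of `le_interferenceSum`. -/
theorem System.interferenceRatio_mul_le {K M N ME : ℕ} (S : System K M N ME) {k i : Fin K}
    (hki : i ≠ k) :
    S.loss.interferenceRatio N k i *
      (S.loss.betaI k * S.loss.beta1 * M * N + S.loss.beta2 k * M) ^ 2 ≤ S.interferenceSum k := by
  refine le_trans (le_of_eq ?_) (le_interferenceSum hki)
  have := S.loss.betaI_pos k
  have := S.loss.beta2_pos k
  have := S.loss.beta1_pos
  have h : S.loss.betaI k * S.loss.beta1 * N + S.loss.beta2 k ≠ 0 := by positivity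
  rw [PathLoss.interferenceRatio]
  field_simp

end RIS

theorem corollary1 {K N : ℕ} (L : RIS.PathLoss K) (k : Fin K) :
    -- explicit forms, and independence of the phase shifts
    (∀ (M ME : ℕ) (S : RIS.System K M N ME), S.loss = L → S.IsUncorrelated →
      (∀ θ : Fin N → ℝ,
        S.gammaUser θ k =
          S.ξ * S.P * (L.betaI k ^ 2 * L.beta1 ^ 2 * M ^ 2 * N ^ 2 +
              2 * L.betaI k * L.beta2 k * L.beta1 * M ^ 2 * N + L.beta2 k ^ 2 * M ^ 2) /
            (S.ξ * S.P * S.interferenceSum k + S.noiseVar k * S.gainSum)) ∧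
      (S.ξ < 1 →
        (∀ θ : Fin N → ℝ,
          S.gammaEve θ k =
            S.ξ * ME * ((M : ℝ) - K) *
                (L.betaI k * L.betaIE * RIS.frobSq (S.H1 * S.H1ᴴ) +
                  (L.betaI k * L.beta3 + L.beta2 k * L.betaIE) * L.beta1 * M * N +
                  L.beta2 k * L.beta3 * M) /
              ((1 - S.ξ) * ((M : ℝ) - K - ME) * (L.beta3 + L.betaIE * L.beta1 * N) *
                S.gainSum)) ∧
        ∀ θ θ' : Fin N → ℝ, S.secrecyRate θ k = S.secrecyRate θ' k)) ∧
    -- persistence of the inter-user interference, uniformly in the number of antennas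
    (2 ≤ K → 1 ≤ N → ∃ c : ℝ, 0 < c ∧
      ∀ (M ME : ℕ) (S : RIS.System K M N ME), S.loss = L → S.IsUncorrelated → 0 < S.ξ →
        (∀ θ : Fin N → ℝ, S.gammaUser θ k ≤ 1 / c) ∧
        ∀ {Ω : Type*} [MeasurableSpace Ω] (μ : Measure Ω) [IsProbabilityMeasure μ]
          (gI : Fin K → Fin N → Ω → ℂ) (gB : Fin K → Fin M → Ω → ℂ),
          RIS.IsFading μ gI gB → ∀ θ : Fin N → ℝ,
            S.interferencePower gI gB μ θ k = S.ξ * S.P * S.interferenceSum k / S.gainSum ∧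
            0 < S.signalPower gI gB μ θ k ∧
            c * S.signalPower gI gB μ θ k ≤ S.interferencePower gI gB μ θ k ∧
            ∀ i, i ≠ k →
              S.cascadedCoherence gI μ θ k i =
                RIS.frobSq (S.H1 * S.H1ᴴ) / (L.beta1 * M * N) ^ 2 ∧
              1 / (N : ℝ) ≤ S.cascadedCoherence gI μ θ k i) := by
  refine ⟨?_, fun hK hN => ?_⟩
  · rintro M ME S rfl hS
    refine ⟨fun θ => ?_, fun _ => ⟨fun θ => hS.gammaEve_eq θ k, fun θ θ' =>
      hS.secrecyRate_eq θ θ' k⟩⟩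
    rw [hS.gammaUser_eq]
    congr 1
    ring
  · have : Nontrivial (Fin K) := Fin.nontrivial_iff_two_le.2 hK
    -- One other user already causes enough interference. It is chosen before `M` and the system, so
    -- the constant does not depend on them.
    obtain ⟨i₀, hi₀⟩ := exists_ne k
    have hc := L.interferenceRatio_pos hN k i₀
    refine ⟨L.interferenceRatio N k i₀, hc, ?_⟩
    rintro M ME S rfl hS hξ
    have hle := S.interferenceRatio_mul_le hi₀
    have hB : 0 < S.gainSum := RIS.System.gainSum_pos k
    have hP := mul_pos hξ S.P_pos
    have hM : (0 : ℝ) < M := by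
      have := S.antennas
      exact_mod_cast (by omega : 0 < M)
    have hN' : (0 : ℝ) < N := by exact_mod_cast hN
    have h1 := S.loss.beta1_pos
    have hT : 0 < (S.loss.betaI k * S.loss.beta1 * M * N + S.loss.beta2 k * M) ^ 2 := by
      have := S.loss.betaI_pos k
      have := S.loss.beta2_pos k
      positivity
    have hA := (mul_pos hc hT).trans_le hle
    refine ⟨fun θ => ?_, ?_⟩
    · have hn := mul_pos (S.noiseVar_pos k) hB
      rw [hS.gammaUser_eq, div_le_div_iff₀ (add_pos (mul_pos hP hA) hn) hc]
      -- The noise term is positive and only enlarges the denominator of `γ_k`.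
      nlinarith [mul_le_mul_of_nonneg_left hle hP.le]
    · intro Ω _ μ _ gI gB hg θ
      rw [hS.signalPower_eq hg, hS.interferencePower_eq hg]
      refine ⟨rfl, div_pos (mul_pos hP hT) hB, ?_, fun i hi => ?_⟩
      · rw [← mul_div_assoc]
        refine div_le_div_of_nonneg_right ?_ hB.le
        nlinarith [mul_le_mul_of_nonneg_left hle hP.le]
      · rw [hS.cascadedCoherence_eq hg θ hi.symm]
        refine ⟨rfl, ?_⟩
        rw [div_le_div_iff₀ hN' (by positivity)]
        -- After cross-multiplication the claim is `(β₁MN)² = N · (N (β₁M)²) ≤ N ‖H₁ H₁ᴴ‖²`.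
        nlinarith [mul_le_mul_of_nonneg_left S.frobSq_H1_ge hN'.le]
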